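/- **Notation and standing assumptions.** Let $X$ be a Hausdorff topological space and $Y$ a Polish space, $\mathbb{R}_{\max}=\mathbb{R}\cup\{-\infty\}$, $\overline{\mathbb{R}}=\mathbb{R}\cup\{\pm\infty\}$, with $-\infty$ absorbing for addition: $(-\infty)+(+\infty)=-\infty$. Let $b:X\times Y\to\mathbb{R}_{\max}$ be lower semicontinuous (l.s.c.) in the second variable, such that for every $x$ there is $y$ with $b(x,y)\in\mathbb{R}$ and for every $y$ there is $x$ with $b(x,y)\in\mathbb{R}$. For $f:Y\to\overline{\mathbb{R}}$ and $g:X\to\overline{\mathbb{R}}$ put $Bf(x)=\sup_{y}(b(x,y)-f(y))$, $B^\circ g(y)=\sup_x(b(x,y)-g(x))$, $\partial^\circ g(x)=\{y: b(x,y)\in\mathbb{R},\ b(x',y)-g(x')\le b(x,y)-g(x)\ \forall x'\in X\}$ and $(\partial^\circ g)^{-1}(y)=\{x: y\in\partial^\circ g(x)\}$. For a map $h$ to $\overline{\mathbb{R}}$ let $\operatorname{ldom}h=\{h<+\infty\}$, $\operatorname{dom}h=\{-\infty<h<+\infty\}$, $\operatorname{idom}h=\{z\in\operatorname{dom}h:\limsup_{z'\to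 z}h(z')<+\infty\}$. For $V\subset X$ put $b_{x,V}(y)=\sup_{z\in V}(b(z,y)-b(x,y))$. The kernel $b$ is *coercive* if for all $x$ and all neighbourhoods $V$ of $x$ the sets $\{b_{x,V}\le\beta\}$, $\beta\in\mathbb{R}$, are relatively compact; it is *upper coercive* if for all $x$ and all neighbourhoods $V$ of $x$ there is a finite $W\subset V$ such that $b(x,\cdot)$ is bounded above on each set $\{b_{x,W}\le\beta\}$, $\beta\in\mathbb{R}$. Let $\mathscr F_c$ be the set of l.s.c. $f:Y\to\overline{\mathbb{R}}$ such that $\{y:b(x,y)-f(y)\ge\beta\}$ is relatively compact for all $x\in X$, $\beta\in\mathbb{R}$. A map $h$ to $\overline{\mathbb R}$ is *quasi-continuous* if $h^{-1}(G)\subset\overline{\operatorname{int}h^{-1}(G)}$ for all open $G\subset\overline{\mathbb{R}}$. Assumption (A4) on $(b,g)$ is the conjunction of: (a) $Y$ is discrete, or $b$ is continuous in the second variable and $B^\circ g>-\infty$ on $Y$; (b) $B^\circ g\in\mathscr F_c$ or $b$ is coercive; (c) $b$ is upper coercive; (d) the restriction of $B^\circ g$ to $\operatorname{dom}B^\circ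 g$ is quasi-continuous. Let $C_b(Y)$ be the set of continuous functions $Y\to\mathbb{R}_{\max}$ bounded above by a constant. A form $F:C_b(Y)\to\overline{\mathbb{R}}$ is *additively homogeneous* if $F(\lambda+\varphi)=\lambda+F(\varphi)$ for all $\lambda\in\mathbb{R}_{\max}$, *max-plus linear* if moreover $F(\varphi\vee\psi)=F(\varphi)\vee F(\psi)$, and *continuous* if $F(\varphi_n)\to F(\varphi)$ whenever $(\varphi_n)$ is nondecreasing in $C_b(Y)$ and converges pointwise to $\varphi\in C_b(Y)$. $\mathscr{QL}$ is the set of isotone, additively homogeneous, continuous $F:C_b(Y)\to\mathbb{R}_{\max}$ such that $F(\varphi\vee\psi)\le\alpha+F(\varphi)\vee F(\psi)$ for all $\varphi,\psi\in C_b(Y)$, for some $\alpha\in\mathbb{R}_{\max}$; $\rho(F)$ is the infimum of such $\alpha$, and $\mathscr L=\{F\in\mathscr{QL}:\rho(F)\le0\}$. A form $F$ is extended to l.s.c. $\varphi:Y\to\mathbb{R}_{\max}$ by $F(\varphi)=\sup\{F(\psi):\psi\in C_b(Y),\psi\le\varphi\}$, then to arbitrary $\varphi:Y\to\mathbb{R}_{\max}$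 by $F(\varphi)=\inf\{F(\psi):\psi:Y\to\mathbb{R}_{\max}\text{ l.s.c.},\psi\ge\varphi\}$; and $F(A):=F(\mathbf 1_A)$ for $A\subset Y$, where $\mathbf 1_A=0$ on $A$ and $-\infty$ elsewhere. A density of $F$ is a map $f:Y\to\overline{\mathbb{R}}$ with $F(\varphi)=\sup_y(\varphi(y)-f(y))$ for all $\varphi\in C_b(Y)$. A sequence $(F_n)$ in $\mathscr{QL}$ is *asymptotically tight* if $\limsup_n\rho(F_n)<+\infty$ and $\inf_{K\text{ compact}}\limsup_nF_n(K^c)=-\infty$. **Theorem.** Let $I$ be a set and, for each $i\in I$, let $(F_{n,i})_{n\in\mathbb N}$ be an asymptotically tight sequence in $\mathscr{QL}$ with $\limsup_nF_{n,i}(Y)<+\infty$ and $\lim_n\rho(F_{n,i})=0$. Let $g(x)=\sup_{i\in I}\limsup_nF_{n,i}(b(x,\cdot))$ for $x\in X$, let $\overline F(\varphi)=\sup_y(\varphi(y)-B^\circ g(y))$ for $\varphi:Y\to\mathbb{R}_{\max}$, so that $\overline F(A)=\sup_{y\in A}(-B^\circ g(y))$, and assume (A4). Then there is a continuous max-plus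 linear form $F:C_b(Y)\to\overline{\mathbb{R}}$, which belongs to $\mathscr L$ if $\sup_{i\in I}\limsup_nF_{n,i}(Y)<+\infty$, having a unique l.s.c. density $f$, such that: 1. $\sup_{i}\limsup_nF_{n,i}(G)\ge F(G)$ for all open $G\subset Y$, and $\sup_{i}\limsup_nF_{n,i}(C)\le F(C)$ for all closed $C\subset Y$. 2. $Bf\le g$ on $X$, and $Bf=g$ on $\operatorname{idom}g\cup g^{-1}(-\infty)$. Moreover $\operatorname{idom}g\subset\bigcup_{y\in\operatorname{ldom}B^\circ g}(\partial^\circ g)^{-1}(y)$. 3. $f\ge B^\circ g$, and $\sup_{i}\limsup_nF_{n,i}(C)\le\overline F(C)$ for all closed $C\subset Y$. 4. Let $Z_a$ be the set of $y\in\operatorname{ldom}B^\circ g$ such that the sets $(\partial^\circ g)^{-1}(z)$, $z\in\operatorname{ldom}B^\circ g\setminus\{y\}$, do not cover $\operatorname{idom}g$; let $Z_t$ be the set of $y\in\operatorname{ldom}B^\circ g$ such that for every open neighbourhood $U$ of $y$ the sets $(\partial^\circ g)^{-1}(z)$, $z\in\operatorname{ldom}B^\circ g\setminus U$, do not cover $\operatorname{idom}g$;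 and let $Z$ be the union of $Z_a$ and of the interior of $Z_t$ relatively to $\operatorname{dom}B^\circ g$. Then $f=B^\circ g$ on $Z$, and $\sup_{i}\limsup_nF_{n,i}(G)\ge\overline F(G\cap Z)$ for all open $G\subset Y$. -/

import Mathlib

open Filter Topology

/-! Conventions: `ℝ ∪ {-∞}` is the set of elements of `EReal` that are `< ⊤`.  In `EReal` one has
`⊥ + ⊤ = ⊥` and `a - b = a + (-b)`, so `-∞` is absorbing for the addition. -/

namespace MaxPlus

/-! ### Domains, Moreau conjugacies, subdifferentials -/

section Conjugacy

variable {X Y : Type*}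

/-- `{z | g z < +∞}` -/
def ldom (g : X → EReal) : Set X := {z | g z < ⊤}

/-- `{z | g z > -∞}` -/
def udom (g : X → EReal) : Set X := {z | ⊥ < g z}

/-- The domain of `g`: the points where `g` is finite. -/
def dom (g : X → EReal) : Set X := ldom g ∩ udom g

/-- The points of the domain at which the limsup of `g` is `< +∞`. -/
def idom [TopologicalSpace X] (g : X → EReal) : Set X :=
  {z | z ∈ dom g ∧ limsup g (𝓝 z) < ⊤}

/-- `B f (x) = sup_y (b(x,y) - f(y))` -/
noncomputable def conj (b : X → Y → EReal) (f : Y → EReal) : X → EReal :=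
  fun x => ⨆ y, (b x y - f y)

/-- `B° g (y) = sup_x (b(x,y) - g(x))` -/
noncomputable def dualConj (b : X → Y → EReal) (g : X → EReal) : Y → EReal :=
  fun y => ⨆ x, (b x y - g x)

/-- The subdifferential `∂° g (x)`, a subset of `Y`. -/
def dualSubdiff (b : X → Y → EReal) (g : X → EReal) (x : X) : Set Y :=
  {y | (⊥ < b x y ∧ b x y < ⊤) ∧ ∀ x', b x' y - g x' ≤ b x y - g x}

/-- `(∂° g)⁻¹(y)`, a subset of `X`. -/
def dualSubdiffInv (b : X → Y → EReal) (g : X → EReal) (y : Y) : Set X :=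
  {x | y ∈ dualSubdiff b g x}

/-- Standing assumptions on the kernel `b`. -/
structure IsKernel [TopologicalSpace Y] (b : X → Y → EReal) : Prop where
  lt_top : ∀ x y, b x y < ⊤
  lsc : ∀ x, LowerSemicontinuous (b x)
  exists_right : ∀ x, ∃ y, ⊥ < b x y
  exists_left : ∀ y, ∃ x, ⊥ < b x y

/-- `b_{x,V}(y) = sup_{z ∈ V} b(z,y) - b(x,y)` -/
noncomputable def kerDiff (b : X → Y → EReal) (x : X) (V : Set X) (y : Y) : EReal :=
  ⨆ z ∈ V, (b z y - b x y)

/-- Coercive kernels: the finite sublevel sets of `b_{x,V}` are relatively compact. -/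
def IsCoercive [TopologicalSpace X] [TopologicalSpace Y] (b : X → Y → EReal) : Prop :=
  ∀ x, ∀ V ∈ 𝓝 x, ∀ β : ℝ, IsCompact (closure {y | kerDiff b x V y ≤ (β : EReal)})

/-- Upper coercive kernels. -/
def IsUpperCoercive [TopologicalSpace X] (b : X → Y → EReal) : Prop :=
  ∀ x, ∀ V ∈ 𝓝 x, ∃ W : Set X, W.Finite ∧ W ⊆ V ∧
    ∀ β : ℝ, ∃ M : ℝ, ∀ y, kerDiff b x W y ≤ (β : EReal) → b x y ≤ (M : EReal)

/-- The set `ℱ_c` of l.s.c. maps `f` such that, for all `x`, the finite superlevel sets of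
`b(x,·) - f` are relatively compact. -/
def MemFc [TopologicalSpace Y] (b : X → Y → EReal) (f : Y → EReal) : Prop :=
  LowerSemicontinuous f ∧
    ∀ x, ∀ β : ℝ, IsCompact (closure {y | (β : EReal) ≤ b x y - f y})

/-- Quasi-continuity: the inverse image of an open set lies in the closure of its interior. -/
def IsQuasiContinuous {Z : Type*} [TopologicalSpace Z] (h : Z → EReal) : Prop :=
  ∀ G : Set EReal, IsOpen G → h ⁻¹' G ⊆ closure (interior (h ⁻¹' G))

/-- `h` is quasi-continuous on its domain. -/
def IsQuasiContinuousOnDom [TopologicalSpace Y] (h : Y → EReal) : Prop :=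
  IsQuasiContinuous (fun z : dom h => h z)

/-- The technical assumption on the kernel `b` and the map `g`. -/
structure TechnicalAssumption [TopologicalSpace X] [TopologicalSpace Y]
    (b : X → Y → EReal) (g : X → EReal) : Prop where
  discrete_or : DiscreteTopology Y ∨
    ((∀ x, Continuous (b x)) ∧ ∀ y, ⊥ < dualConj b g y)
  memFc_or : MemFc b (dualConj b g) ∨ IsCoercive b
  upperCoercive : IsUpperCoercive b
  quasiContinuous : IsQuasiContinuousOnDom (dualConj b g)

end Conjugacy

/-! ### Coverings -/

section Covering

variable {Z W : Type*}

/-- `{Φ(z)}_{z ∈ Z'}` is a covering of `W'`. -/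
def IsCovering (Φ : Z → Set W) (Z' : Set Z) (W' : Set W) : Prop :=
  W' ⊆ ⋃ z ∈ Z', Φ z

/-- The algebraically essential elements of `Z'`. -/
def algEssential (Φ : Z → Set W) (Z' : Set Z) (W' : Set W) : Set Z :=
  {y | y ∈ Z' ∧ ¬ IsCovering Φ (Z' \ {y}) W'}

/-- The topologically essential elements of `Z'`. -/
def topEssential [TopologicalSpace Z] (Φ : Z → Set W) (Z' : Set Z) (W' : Set W) : Set Z :=
  {y | y ∈ Z' ∧ ∀ U : Set Z, IsOpen U → y ∈ U → ¬ IsCovering Φ (Z' \ U) W'}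

/-- The interior of `A` relatively to `D`. -/
def relInterior [TopologicalSpace Z] (A D : Set Z) : Set Z :=
  {y | y ∈ D ∧ ∃ U : Set Z, IsOpen U ∧ y ∈ U ∧ U ∩ D ⊆ A}

end Covering

/-- The set `Z = Z_a ∪ int Z_t` associated with the covering of `X' ∩ udom g` by the sets
`(∂° g)⁻¹(y)`, `y ∈ ldom (B° g)`; the interior is relative to `dom (B° g)`. -/
def essentialSet {X Y : Type*} [TopologicalSpace Y] (b : X → Y → EReal) (g : X → EReal)
    (X' : Set X) : Set Y :=
  algEssential (dualSubdiffInv b g) (ldom (dualConj b g)) (X' ∩ udom g) ∪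
    relInterior (topEssential (dualSubdiffInv b g) (ldom (dualConj b g)) (X' ∩ udom g))
      (dom (dualConj b g))

/-! ### Quasi-linear forms -/

section Forms

variable {Y : Type*} [TopologicalSpace Y]

variable (Y) in
/-- `C_b(Y)`: continuous functions from `Y` to `ℝ ∪ {-∞}` bounded above by a constant. -/
def Cb : Type _ := {φ : Y → EReal // Continuous φ ∧ ∃ c : ℝ, ∀ y, φ y ≤ (c : EReal)}

instance : CoeFun (Cb Y) (fun _ => Y → EReal) := ⟨fun φ => φ.1⟩

/-- Pointwise order. -/
instance : PartialOrder (Cb Y) :=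
  inferInstanceAs (PartialOrder {φ : Y → EReal // Continuous φ ∧ ∃ c : ℝ, ∀ y, φ y ≤ (c : EReal)})

/-- Pointwise maximum. -/
noncomputable instance : Max (Cb Y) :=
  ⟨fun φ ψ => ⟨fun y => φ y ⊔ ψ y, φ.2.1.sup ψ.2.1, by
    obtain ⟨c, hc⟩ := φ.2.2
    obtain ⟨d, hd⟩ := ψ.2.2
    refine ⟨max c d, fun y => ?_⟩
    rw [EReal.coe_strictMono.monotone.map_max]
    exact sup_le_sup (hc y) (hd y)⟩⟩

/-- The function `a + φ`, for `a ∈ ℝ ∪ {-∞}`. -/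
noncomputable def Cb.shift (a : EReal) (ha : a < ⊤) (φ : Cb Y) : Cb Y :=
  ⟨fun y => a + φ y, by
    obtain ⟨c, hc⟩ := φ.2.2
    constructor
    · induction a with
      | bot => simpa using continuous_const
      | top => exact absurd ha (lt_irrefl _)
      | coe r =>
        rw [continuous_iff_continuousAt]
        intro y
        have h : ContinuousAt (fun p : EReal × EReal => p.1 + p.2) ((r : EReal), φ y) :=
          EReal.continuousAt_add (Or.inl (EReal.coe_ne_top r)) (Or.inl (EReal.coe_ne_bot r))
        exact ContinuousAt.comp (f := fun y => ((r : EReal), φ y)) h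
          (continuousAt_const.prodMk φ.2.1.continuousAt)
    · refine ⟨a.toReal + c, fun y => ?_⟩
      rw [EReal.coe_add]
      exact add_le_add (EReal.le_coe_toReal ha.ne) (hc y)⟩

/-- Isotony. -/
def IsIsotone (F : Cb Y → EReal) : Prop := ∀ φ ψ : Cb Y, φ ≤ ψ → F φ ≤ F ψ

/-- Additive homogeneity. -/
def IsHomogeneous (F : Cb Y → EReal) : Prop :=
  ∀ (a : EReal) (ha : a < ⊤) (φ : Cb Y), F (Cb.shift a ha φ) = a + F φ

/-- `F(φ ∨ ψ) ≤ α + F(φ) ∨ F(ψ)` for all `φ, ψ`. -/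
def IsQuasiSupWith (α : EReal) (F : Cb Y → EReal) : Prop :=
  ∀ φ ψ : Cb Y, F (φ ⊔ ψ) ≤ α + (F φ ⊔ F ψ)

/-- Continuity of a form: it preserves nondecreasing converging sequences. -/
def IsContinuousForm (F : Cb Y → EReal) : Prop :=
  ∀ (φ : ℕ → Cb Y) (ψ : Cb Y), Monotone φ →
    (∀ y, Tendsto (fun n => φ n y) atTop (𝓝 (ψ y))) →
    Tendsto (fun n => F (φ n)) atTop (𝓝 (F ψ))

/-- `ρ(F)`: the infimum of the `α ∈ ℝ ∪ {-∞}` with `F(φ ∨ ψ) ≤ α + F(φ) ∨ F(ψ)`. -/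
noncomputable def rho (F : Cb Y → EReal) : EReal :=
  sInf {α : EReal | α < ⊤ ∧ IsQuasiSupWith α F}

/-- `F` is a continuous quasi-linear form on `C_b(Y)` with values in `ℝ ∪ {-∞}`. -/
structure IsQL (F : Cb Y → EReal) : Prop where
  lt_top : ∀ φ, F φ < ⊤
  isotone : IsIsotone F
  homogeneous : IsHomogeneous F
  quasi : ∃ α : EReal, α < ⊤ ∧ IsQuasiSupWith α F
  cont : IsContinuousForm F

/-- `F` is a continuous max-plus linear form on `C_b(Y)` with values in `ℝ ∪ {-∞}`. -/
def IsL (F : Cb Y → EReal) : Prop := IsQL F ∧ rho F ≤ 0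

/-- `F` is a max-plus linear form on `C_b(Y)`, with values in `ℝ ∪ {±∞}`. -/
structure IsMaxPlusLinear (F : Cb Y → EReal) : Prop where
  homogeneous : IsHomogeneous F
  map_sup : ∀ φ ψ : Cb Y, F (φ ⊔ ψ) = F φ ⊔ F ψ

/-- `f` is a density of `F`. -/
def IsDensity (F : Cb Y → EReal) (f : Y → EReal) : Prop :=
  ∀ φ : Cb Y, F φ = ⨆ y, (φ y - f y)

/-- Extension of `F` to l.s.c. functions. -/
noncomputable def extLsc (F : Cb Y → EReal) (φ : Y → EReal) : EReal :=
  ⨆ (ψ : Cb Y) (_ : ∀ y, ψ y ≤ φ y), F ψ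

/-- Maximal extension of `F` to all functions from `Y` to `ℝ ∪ {-∞}`; it agrees with `extLsc` on
l.s.c. functions. -/
noncomputable def ext (F : Cb Y → EReal) (φ : Y → EReal) : EReal :=
  ⨅ (ψ : Y → EReal) (_ : LowerSemicontinuous ψ ∧ (∀ y, ψ y < ⊤) ∧ ∀ y, φ y ≤ ψ y), extLsc F ψ

theorem ext_eq_extLsc (F : Cb Y → EReal) (φ : Y → EReal) (h : LowerSemicontinuous φ)
    (h' : ∀ y, φ y < ⊤) : ext F φ = extLsc F φ := by
  apply le_antisymm
  · exact iInf₂_le φ ⟨h, h', fun _ => le_rfl⟩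
  · refine le_iInf₂ fun ψ hψ => iSup₂_le fun χ hχ => ?_
    exact le_iSup₂ (f := fun (ψ' : Cb Y) (_ : ∀ y, ψ' y ≤ ψ y) => F ψ') χ
      fun y => (hχ y).trans (hψ.2.2 y)

open Classical in
/-- Max-plus characteristic function: `0` on `A` and `-∞` outside `A`. -/
noncomputable def ind (A : Set Y) : Y → EReal := fun y => if y ∈ A then 0 else ⊥

/-- `F(A)`, the value of the maximal extension of `F` at the characteristic function of `A`. -/
noncomputable def onSet (F : Cb Y → EReal) (A : Set Y) : EReal := ext F (ind A)

/-- The max-plus linear form `φ ↦ sup_y (φ(y) - h(y))` with density `h`, on all functions from `Y`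
to `ℝ ∪ {-∞}`. -/
noncomputable def densForm (h : Y → EReal) (φ : Y → EReal) : EReal := ⨆ y, (φ y - h y)

/-- Asymptotic tightness of a sequence of forms. -/
def IsAsympTight (F : ℕ → Cb Y → EReal) : Prop :=
  limsup (fun n => rho (F n)) atTop < ⊤ ∧
    ⨅ (K : Set Y) (_ : IsCompact K), limsup (fun n => onSet (F n) Kᶜ) atTop = ⊥

end Forms

end MaxPlus

open MaxPlus

namespace MaxPlus

/-! Put `S A = ⨆ i, limsup F_{n,i}(A)`. The density is the rate function `f = rate S`, for which `-f
y` is the infimum of `S` over the open neighbourhoods of `y`; the open bound is then immediate.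

The closed bound comes from a compactness argument. Since `rho → 0`, the upper limits behave well
under finite maxima (`upperLim_sup_le`). Tightness discards the complement of a compact set, and a
finite cover of that set bounds an upper semicontinuous, bounded above `φ` by finitely many
translated indicators (`upperLim_le_densForm`).

Testing on the open sets `{b x > r}` gives `B f ≤ g`, hence `f ≥ B° g` by duality. On `idom g`,
upper coercivity reduces the unbounded function `b x` to a truncation plus finitely many nearby
kernels, which gives `B f = g` (`le_conj_of_mem_idom`).

Compactness of superlevel sets then makes the supremum `B f x` attained, and a maximizer `y` lies in
`∂° g(x)` with `f y = B° g y` (`exists_mem_dualSubdiff`). Hence the covering; moreover, a point that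
the covering cannot spare must be, or be approached by, such maximizers, which forces `f = B° g` on
the essential set. -/

theorem sub_le_of_forall_coe_lt {a f s : EReal} (h : ∀ r : ℝ, (r : EReal) < a → r - f ≤ s) :
    a - f ≤ s := by
  induction f with
  | top => simp
  | bot =>
    rcases eq_or_ne a ⊥ with rfl | ha
    · simp
    · obtain ⟨r, -, hr⟩ := EReal.lt_iff_exists_real_btwn.1 (bot_lt_iff_ne_bot.2 ha)
      have := h r hr
      rw [EReal.coe_sub_bot] at this
      exact le_top.trans this
  | coe c =>
    rw [EReal.sub_le_iff_le_add (by simp) (by simp)]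
    refine EReal.ge_of_forall_gt_iff_ge.1 fun r hr => ?_
    exact (EReal.sub_le_iff_le_add (by simp) (by simp)).1 (h r hr)

theorem sub_le_comm_of_lt_top {a f s : EReal} (ha : a < ⊤) : a - f ≤ s ↔ a - s ≤ f := by
  induction a with
  | bot => simp
  | top => simp at ha
  | coe a =>
    induction f <;> induction s <;> try simp [← EReal.coe_sub]
    constructor <;> intro h <;> linarith

/-! ### Duality between the two conjugacies -/

section Conjugacy

variable {X Y : Type*}

/-- Galois connection: both sides unfold to the same family of inequalities indexed by pairs `(x,
y)`. -/
theorem dualConj_le_iff {b : X → Y → EReal} (hb : ∀ x y, b x y < ⊤) {f : Y → EReal}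
    {g : X → EReal} : (∀ y, dualConj b g y ≤ f y) ↔ ∀ x, conj b f x ≤ g x := by
  simp only [dualConj, conj, iSup_le_iff]
  rw [forall_comm]
  exact forall_congr' fun x => forall_congr' fun y => sub_le_comm_of_lt_top (hb x y)

end Conjugacy

/-! ### Max-plus indicators and approximation by `Cb Y` -/

section Indicator

variable {Y : Type*}

theorem ind_mono {A B : Set Y} (h : A ⊆ B) (y : Y) : ind A y ≤ ind B y := by
  unfold ind
  split_ifs with h1 h2
  · exact le_rfl
  · exact absurd (h h1) h2
  · exact bot_le
  · exact le_rfl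

theorem ind_of_mem {A : Set Y} {y : Y} (h : y ∈ A) : ind A y = 0 := if_pos h

theorem ind_of_notMem {A : Set Y} {y : Y} (h : y ∉ A) : ind A y = ⊥ := if_neg h

theorem ind_lt_top (A : Set Y) (y : Y) : ind A y < ⊤ := by
  unfold ind
  split_ifs <;> simp

end Indicator

section Approximation

variable {Y : Type*} [TopologicalSpace Y]

theorem lowerSemicontinuous_coe_add_ind (c : ℝ) {G : Set Y} (hG : IsOpen G) :
    LowerSemicontinuous fun y => (c : EReal) + ind G y := by
  intro y a ha
  by_cases hy : y ∈ G
  · filter_upwards [hG.mem_nhds hy] with z hz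
    rwa [ind_of_mem hz, ← ind_of_mem hy]
  · simp [ind_of_notMem hy] at ha

theorem lowerSemicontinuous_ind {G : Set Y} (hG : IsOpen G) : LowerSemicontinuous (ind G) := by
  simpa using lowerSemicontinuous_coe_add_ind 0 hG

theorem upperSemicontinuous_ind {C : Set Y} (hC : IsClosed C) : UpperSemicontinuous (ind C) := by
  intro y a ha
  by_cases hy : y ∈ C
  · rw [ind_of_mem hy] at ha
    refine Eventually.of_forall fun z => lt_of_le_of_lt ?_ ha
    unfold ind
    split_ifs <;> simp
  · filter_upwards [hC.isOpen_compl.mem_nhds hy] with z hz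
    rwa [ind_of_notMem hz, ← ind_of_notMem hy]

/-- A lower semicontinuous function is the supremum of its minorants in `C_b(Y)`. -/
theorem exists_Cb_le_of_lt [TopologicalSpace.MetrizableSpace Y] {φ : Y → EReal}
    (hφ : LowerSemicontinuous φ) {y : Y} {r : ℝ} (hr : (r : EReal) < φ y) :
    ∃ χ : Cb Y, (∀ z, χ z ≤ φ z) ∧ χ y = r := by
  let := TopologicalSpace.metrizableSpaceMetric Y
  obtain ⟨δ, hδ, hball⟩ := Metric.mem_nhds_iff.1 (hφ y r hr)
  -- The logarithm turns a `[0,1]`-valued bump at `y` into a max-plus one: `0` at `y`, `-∞` off the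
  -- ball.
  have hc : Continuous fun z => ENNReal.log (thickenedIndicatorAux δ {y} z) :=
    ENNReal.continuous_log.comp (continuous_thickenedIndicatorAux hδ {y})
  have hle : ∀ z, ENNReal.log (thickenedIndicatorAux δ {y} z) ≤ 0 := fun z => by
    rw [← ENNReal.log_one]
    exact ENNReal.log_monotone (thickenedIndicatorAux_le_one _ _ _)
  refine ⟨Cb.shift r (EReal.coe_lt_top r) ⟨_, hc, 0, hle⟩, fun z => ?_, ?_⟩
  · change (r : EReal) + ENNReal.log _ ≤ _
    by_cases hz : z ∈ Metric.ball y δ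
    · refine le_trans ?_ (hball hz : (r : EReal) < φ z).le
      simpa using add_le_add (le_refl (r : EReal)) (hle z)
    · rw [thickenedIndicatorAux_zero hδ {y}]
      · simp
      · simpa [Metric.thickening_singleton] using hz
  · change (r : EReal) + ENNReal.log _ = _
    rw [thickenedIndicatorAux_one δ {y} (Set.mem_singleton y)]
    simp

/-- A lower semicontinuous function on a Polish space is the limit of a nondecreasing sequence
in `C_b(Y)`. -/
theorem exists_monotone_Cb [PolishSpace Y] {φ : Y → EReal} (hφ : LowerSemicontinuous φ) :
    ∃ χ : ℕ → Cb Y, Monotone χ ∧ (∀ n y, χ n y ≤ φ y) ∧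
      ∀ y, ∀ a < φ y, ∃ n, a < χ n y := by
  let 𝓕 : Set (Y → EReal) := {ψ | ∃ χ : Cb Y, χ.1 = ψ ∧ ∀ z, χ z ≤ φ z}
  have hlub : IsLUB 𝓕 φ := by
    refine isLUB_pi.2 fun y => ⟨?_, fun u hu => ?_⟩
    · rintro _ ⟨_, ⟨χ, rfl, hχ⟩, rfl⟩
      exact hχ y
    · refine EReal.ge_of_forall_gt_iff_ge.1 fun r hr => ?_
      obtain ⟨χ, hχ, hy⟩ := exists_Cb_le_of_lt hφ hr
      exact hy ▸ hu ⟨χ.1, ⟨χ, rfl, hχ⟩, rfl⟩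
  obtain ⟨𝓖, hsub, hcount, hlub'⟩ := exists_countable_lowerSemicontinuous_isLUB
    (by rintro _ ⟨χ, rfl, -⟩; exact χ.2.1.lowerSemicontinuous) hlub
  -- Adjoining the constant `⊥` makes the countable family nonempty, so that it can be enumerated;
  -- running maxima `v` then make it monotone.
  let χbot : Cb Y := ⟨fun _ => ⊥, continuous_const, 0, fun _ => bot_le⟩
  have hcount' : ({χ : Cb Y | χ.1 ∈ 𝓖} ∪ {χbot}).Countable :=
    (hcount.preimage Subtype.val_injective).union (Set.countable_singleton _)
  obtain ⟨u, hu⟩ := hcount'.exists_eq_range ⟨χbot, Or.inr rfl⟩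
  have hule : ∀ n z, u n z ≤ φ z := fun n z => by
    have : u n ∈ ({χ : Cb Y | χ.1 ∈ 𝓖} ∪ {χbot}) := hu ▸ Set.mem_range_self n
    rcases this with h | h
    · obtain ⟨χ, h1, h2⟩ := hsub h
      rw [← h1]
      exact h2 z
    · rw [Set.mem_singleton_iff.1 h]
      exact bot_le
  let v : ℕ → Cb Y := fun n => n.rec (u 0) fun k w => w ⊔ u (k + 1)
  have hv : ∀ n, v (n + 1) = v n ⊔ u (n + 1) := fun n => rfl
  have huv : ∀ n z, u n z ≤ v n z := by
    rintro (_ | n) z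
    · exact le_rfl
    · rw [hv]
      exact le_sup_right
  refine ⟨v, monotone_nat_of_le_succ fun n z => ?_, fun n => ?_, fun y a ha => ?_⟩
  · rw [hv]
    exact le_sup_left
  · induction n with
    | zero => exact hule 0
    | succ n ih =>
      rw [hv]
      exact fun z => sup_le (ih z) (hule _ z)
  · obtain ⟨_, ⟨ψ, hψ, rfl⟩, hlt⟩ := (lt_isLUB_iff (isLUB_pi.1 hlub' y)).1 ha
    obtain ⟨χ, h1, h2⟩ := hsub hψ
    have : χ ∈ Set.range u := hu ▸ Or.inl (show χ.1 ∈ 𝓖 from h1 ▸ hψ)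
    obtain ⟨n, rfl⟩ := this
    refine ⟨n, lt_of_lt_of_le ?_ (huv n y)⟩
    rw [h1]
    exact hlt

end Approximation

/-! ### Forms given by a density, on arbitrary functions -/

section DensForm

variable {Y : Type*}

theorem densForm_ind (f : Y → EReal) (A : Set Y) : densForm f (ind A) = ⨆ y ∈ A, -f y := by
  refine iSup_congr fun y => ?_
  by_cases hy : y ∈ A
  · simp [ind_of_mem hy, hy]
  · simp [ind_of_notMem hy, hy]

theorem densForm_mono (f : Y → EReal) {φ ψ : Y → EReal} (h : ∀ y, φ y ≤ ψ y) :
    densForm f φ ≤ densForm f ψ :=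
  iSup_mono fun y => EReal.sub_le_sub (h y) le_rfl

theorem densForm_anti {f f' : Y → EReal} (h : ∀ y, f y ≤ f' y) (φ : Y → EReal) :
    densForm f' φ ≤ densForm f φ :=
  iSup_mono fun y => EReal.sub_le_sub le_rfl (h y)

end DensForm

/-! ### Quasi-linear forms extended to l.s.c. functions -/

section QuasiLinear

variable {Y : Type*} [TopologicalSpace Y]

theorem ext_mono {F : Cb Y → EReal} {φ ψ : Y → EReal} (h : ∀ y, φ y ≤ ψ y) :
    ext F φ ≤ ext F ψ :=
  le_iInf₂ fun χ hχ => iInf₂_le χ ⟨hχ.1, hχ.2.1, fun y => (h y).trans (hχ.2.2 y)⟩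

theorem extLsc_bot {F : Cb Y → EReal} (hF : IsHomogeneous F) : extLsc F ⊥ = ⊥ := by
  refine le_bot_iff.1 (iSup₂_le fun χ hχ => ?_)
  have h : Cb.shift ⊥ bot_lt_top χ = χ :=
    Subtype.ext <| funext fun y => by
      change ⊥ + χ y = χ y
      rw [EReal.bot_add, eq_comm]
      exact le_bot_iff.1 (hχ y)
  rw [← h, hF, EReal.bot_add]

/-- Shifting by `-c` sends the minorants of `c + φ` to minorants of `φ`. -/
theorem extLsc_coe_add_le {F : Cb Y → EReal} (hF : IsHomogeneous F) (c : ℝ) (φ : Y → EReal) :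
    extLsc F (fun y => c + φ y) ≤ c + extLsc F φ := by
  refine iSup₂_le fun χ hχ => ?_
  have h : F (Cb.shift ((-c : ℝ) : EReal) (EReal.coe_lt_top _) χ) ≤ extLsc F φ := by
    refine le_iSup₂ (f := fun (χ : Cb Y) (_ : ∀ y, χ y ≤ φ y) => F χ) _ fun y => ?_
    change ((-c : ℝ) : EReal) + χ y ≤ φ y
    rw [EReal.coe_neg, add_comm, ← sub_eq_add_neg,
      EReal.sub_le_iff_le_add (by simp) (by simp), add_comm]
    exact hχ y
  rw [hF, EReal.coe_neg, add_comm, ← sub_eq_add_neg,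
    EReal.sub_le_iff_le_add (by simp) (by simp), add_comm] at h
  exact h

theorem isQuasiSupWith_of_rho_lt {F : Cb Y → EReal} {ε : EReal} (h : rho F < ε) :
    IsQuasiSupWith ε F := by
  obtain ⟨α, hα, hlt⟩ := sInf_lt_iff.1 h
  exact fun φ ψ => (hα.2 φ ψ).trans (add_le_add hlt.le le_rfl)

/-- Approximate both functions from below by nondecreasing sequences in `Cb Y`; continuity of `F`
carries the inequality to the limit. -/
theorem extLsc_sup_le [PolishSpace Y] {F : Cb Y → EReal} (hF : IsQL F) {α : EReal}
    (hα : IsQuasiSupWith α F) {φ ψ : Y → EReal} (hφ : LowerSemicontinuous φ)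
    (hψ : LowerSemicontinuous ψ) :
    extLsc F (φ ⊔ ψ) ≤ α + (extLsc F φ ⊔ extLsc F ψ) := by
  obtain ⟨u, hu, hule, hulim⟩ := exists_monotone_Cb hφ
  obtain ⟨v, hv, hvle, hvlim⟩ := exists_monotone_Cb hψ
  refine iSup₂_le fun χ hχ => ?_
  obtain ⟨c, hc⟩ := χ.2.2
  -- Continuity of `F` needs a limit in `Cb Y`, and `φ ⊔ ψ` need not be one; cutting by `χ` gives a
  -- sequence increasing to `χ`.
  let w : ℕ → Cb Y := fun n =>
    ⟨fun y => χ y ⊓ (u n ⊔ v n : Cb Y) y, χ.2.1.inf (u n ⊔ v n : Cb Y).2.1, c,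
      fun y => inf_le_left.trans (hc y)⟩
  have hw : Monotone w := fun m n hmn y =>
    inf_le_inf le_rfl (sup_le_sup (hu hmn y) (hv hmn y))
  have hlim : Tendsto (fun n => F (w n)) atTop (𝓝 (F χ)) := by
    refine hF.cont w χ hw fun y => ?_
    refine tendsto_order.2 ⟨fun a ha => ?_, fun a ha =>
      Eventually.of_forall fun n => lt_of_le_of_lt inf_le_left ha⟩
    have : ∃ N, a < (u N ⊔ v N : Cb Y) y := by
      rcases lt_sup_iff.1 (ha.trans_le (hχ y)) with h | h
      · obtain ⟨N, hN⟩ := hulim y a h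
        exact ⟨N, lt_of_lt_of_le hN le_sup_left⟩
      · obtain ⟨N, hN⟩ := hvlim y a h
        exact ⟨N, lt_of_lt_of_le hN le_sup_right⟩
    obtain ⟨N, hN⟩ := this
    filter_upwards [eventually_ge_atTop N] with n hn
    exact lt_of_lt_of_le (lt_inf_iff.2 ⟨ha, hN⟩) (hw hn y)
  refine le_of_tendsto' hlim fun n => ?_
  calc F (w n) ≤ F (u n ⊔ v n) := hF.isotone _ _ fun y => inf_le_right
    _ ≤ α + (F (u n) ⊔ F (v n)) := hα _ _
    _ ≤ _ := by
      refine add_le_add le_rfl (sup_le_sup ?_ ?_)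
      · exact le_iSup₂ (f := fun (χ : Cb Y) (_ : ∀ y, χ y ≤ φ y) => F χ) (u n) (hule n)
      · exact le_iSup₂ (f := fun (χ : Cb Y) (_ : ∀ y, χ y ≤ ψ y) => F χ) (v n) (hvle n)

end QuasiLinear

/-! ### Upper limits of a sequence of forms -/

section UpperLimit

variable {Y : Type*} [TopologicalSpace Y]

/-- `limsup_n F_n(φ)` -/
noncomputable def upperLim (F : ℕ → Cb Y → EReal) (φ : Y → EReal) : EReal :=
  limsup (fun n => ext (F n) φ) atTop

theorem upperLim_mono {F : ℕ → Cb Y → EReal} {φ ψ : Y → EReal} (h : ∀ y, φ y ≤ ψ y) :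
    upperLim F φ ≤ upperLim F ψ :=
  limsup_le_limsup (Eventually.of_forall fun _ => ext_mono h)

/-- Lower semicontinuous functions with values in `ℝ ∪ {-∞}`. -/
def IsLscLtTop (φ : Y → EReal) : Prop := LowerSemicontinuous φ ∧ ∀ y, φ y < ⊤

theorem IsLscLtTop.sup {φ ψ : Y → EReal} (hφ : IsLscLtTop φ) (hψ : IsLscLtTop ψ) :
    IsLscLtTop (φ ⊔ ψ) :=
  ⟨hφ.1.sup hψ.1, fun y => sup_lt_iff.2 ⟨hφ.2 y, hψ.2 y⟩⟩

theorem isLscLtTop_ind {G : Set Y} (hG : IsOpen G) : IsLscLtTop (ind G) :=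
  ⟨lowerSemicontinuous_ind hG, ind_lt_top G⟩

theorem IsLscLtTop.coe_add {φ : Y → EReal} (hφ : IsLscLtTop φ) (c : ℝ) :
    IsLscLtTop fun y => (c : EReal) + φ y := by
  refine ⟨fun y a ha => ?_, fun y => EReal.add_lt_top (EReal.coe_ne_top c) (hφ.2 y).ne⟩
  filter_upwards [hφ.1 y _ (EReal.sub_lt_of_lt_add' ha)] with z hz
  rw [add_comm]
  exact (EReal.sub_lt_iff (by simp) (by simp)).1 hz

theorem upperLim_coe_add_le {F : ℕ → Cb Y → EReal} (hF : ∀ n, IsQL (F n)) (c : ℝ)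
    {φ : Y → EReal} (hφ : IsLscLtTop φ) :
    upperLim F (fun y => c + φ y) ≤ c + upperLim F φ := by
  have h : ∀ n, ext (F n) (fun y => c + φ y) ≤ c + ext (F n) φ := fun n => by
    rw [ext_eq_extLsc _ _ (hφ.coe_add c).1 (hφ.coe_add c).2, ext_eq_extLsc _ _ hφ.1 hφ.2]
    exact extLsc_coe_add_le (hF n).homogeneous c φ
  refine (limsup_le_limsup (Eventually.of_forall h)).trans ?_
  refine (EReal.limsup_add_le (u := fun _ => (c : EReal)) ?_ ?_).trans ?_ <;> simp [upperLim]

/-- A max-plus Chebyshev inequality; translating back by `-c` reverses `upperLim_coe_add_le`. -/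
theorem coe_add_upperLim_ind_le {F : ℕ → Cb Y → EReal} (hF : ∀ n, IsQL (F n)) {c : ℝ}
    {G : Set Y} (hG : IsOpen G) {φ : Y → EReal} (h : ∀ y ∈ G, (c : EReal) ≤ φ y) :
    c + upperLim F (ind G) ≤ upperLim F φ := by
  have h1 : upperLim F (fun y => (c : EReal) + ind G y) ≤ upperLim F φ := by
    refine upperLim_mono fun y => ?_
    by_cases hy : y ∈ G
    · simpa [ind_of_mem hy] using h y hy
    · simp [ind_of_notMem hy]
  have h2 := upperLim_coe_add_le hF (-c) ((isLscLtTop_ind hG).coe_add c)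
  have h3 : (fun y => ((-c : ℝ) : EReal) + (c + ind G y)) = ind G := by
    ext y
    rw [← add_assoc, ← EReal.coe_add, neg_add_cancel, EReal.coe_zero, zero_add]
  rw [h3, EReal.coe_neg, add_comm, ← sub_eq_add_neg] at h2
  have h4 := EReal.add_le_of_le_sub h2
  rw [add_comm]
  exact h4.trans h1

/-- For reals `γ < s < r`, both terms are eventually below `s` and the defect `rho (F n)` is
eventually below `r - s`, so it disappears in the limit. -/
theorem upperLim_sup_le [PolishSpace Y] {F : ℕ → Cb Y → EReal} (hF : ∀ n, IsQL (F n))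
    (hrho : Tendsto (fun n => rho (F n)) atTop (𝓝 0)) {φ ψ : Y → EReal}
    (hφ : IsLscLtTop φ) (hψ : IsLscLtTop ψ) {γ : EReal}
    (hφγ : upperLim F φ ≤ γ) (hψγ : upperLim F ψ ≤ γ) : upperLim F (φ ⊔ ψ) ≤ γ := by
  refine EReal.le_of_forall_lt_iff_le.1 fun r hr => ?_
  obtain ⟨s, hs, hsr⟩ := EReal.lt_iff_exists_real_btwn.1 hr
  have hε : (0 : EReal) < ((r - s : ℝ) : EReal) := by
    exact_mod_cast sub_pos.2 (EReal.coe_lt_coe_iff.1 hsr)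
  refine limsup_le_of_le ?_ ?_
  · exact isCobounded_le_of_bot
  filter_upwards [eventually_lt_of_limsup_lt (hφγ.trans_lt hs),
    eventually_lt_of_limsup_lt (hψγ.trans_lt hs), hrho.eventually_lt_const hε] with n h1 h2 h3
  rw [ext_eq_extLsc _ _ hφ.1 hφ.2] at h1
  rw [ext_eq_extLsc _ _ hψ.1 hψ.2] at h2
  rw [ext_eq_extLsc _ _ (hφ.sup hψ).1 (hφ.sup hψ).2]
  refine (extLsc_sup_le (hF n) (isQuasiSupWith_of_rho_lt h3) hφ.1 hψ.1).trans ?_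
  refine (add_le_add le_rfl (sup_le h1.le h2.le)).trans ?_
  rw [← EReal.coe_add, sub_add_cancel]

theorem upperLim_bot {F : ℕ → Cb Y → EReal} (hF : ∀ n, IsQL (F n)) : upperLim F ⊥ = ⊥ := by
  have h : ∀ n, ext (F n) ⊥ = ⊥ := fun n => by
    have hbot : LowerSemicontinuous (⊥ : Y → EReal) := lowerSemicontinuous_const
    rw [ext_eq_extLsc _ _ hbot fun _ => bot_lt_top]
    exact extLsc_bot (hF n).homogeneous
  simp [upperLim, h]

theorem upperLim_finset_sup_le [PolishSpace Y] {F : ℕ → Cb Y → EReal} (hF : ∀ n, IsQL (F n))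
    (hrho : Tendsto (fun n => rho (F n)) atTop (𝓝 0)) {ι : Type*} {s : Finset ι}
    {ψ : ι → Y → EReal} {γ : EReal} (hψ : ∀ k ∈ s, IsLscLtTop (ψ k) ∧ upperLim F (ψ k) ≤ γ) :
    IsLscLtTop (s.sup ψ) ∧ upperLim F (s.sup ψ) ≤ γ := by
  refine Finset.sup_induction (p := fun φ => IsLscLtTop φ ∧ upperLim F φ ≤ γ) ?_ ?_ hψ
  · exact ⟨⟨lowerSemicontinuous_const, fun _ => bot_lt_top⟩, (upperLim_bot hF).le.trans bot_le⟩
  · exact fun φ hφ ψ hψ => ⟨hφ.1.sup hψ.1, upperLim_sup_le hF hrho hφ.1 hψ.1 hφ.2 hψ.2⟩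

/-- Upper bound for the limits of the values at upper semicontinuous functions which are bounded
above. -/
theorem upperLim_le_densForm [PolishSpace Y] {F : ℕ → Cb Y → EReal} (hF : ∀ n, IsQL (F n))
    (hrho : Tendsto (fun n => rho (F n)) atTop (𝓝 0)) (htight : IsAsympTight F)
    (hY : upperLim F (ind Set.univ) < ⊤) {f : Y → EReal}
    (hf : ∀ y, ∀ a : ℝ, (a : EReal) < f y →
      ∃ G, IsOpen G ∧ y ∈ G ∧ upperLim F (ind G) ≤ ((-a : ℝ) : EReal))
    {φ : Y → EReal} (hφ : UpperSemicontinuous φ) {C : ℝ} (hC : ∀ y, φ y ≤ C) :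
    upperLim F φ ≤ densForm f φ := by
  refine EReal.le_of_forall_lt_iff_le.1 fun γ hγ => ?_
  -- Near each point, `φ` is dominated by a translated indicator of upper limit at most `γ`.
  have hloc : ∀ y, ∃ (c : ℝ) (G : Set Y), IsOpen G ∧ y ∈ G ∧ (∀ z ∈ G, φ z ≤ c) ∧
      upperLim F (fun z => (c : EReal) + ind G z) ≤ γ := by
    intro y
    have hy : φ y - f y < γ := (le_iSup (fun y => φ y - f y) y).trans_lt hγ
    rcases eq_or_ne (φ y) ⊥ with hbot | hbot
    -- Here `f y` gives no information; a bound `M` on the total mass suffices, since `φ < γ - M`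
    -- near `y`.
    · obtain ⟨M, hM, -⟩ := EReal.lt_iff_exists_real_btwn.1 hY
      have ho : IsOpen {z | φ z < ((γ - M : ℝ) : EReal)} := hφ.isOpen_preimage _
      refine ⟨γ - M, {z | φ z < ((γ - M : ℝ) : EReal)}, ho, ?_, fun z hz => le_of_lt hz, ?_⟩
      · change φ y < _
        rw [hbot]
        exact EReal.bot_lt_coe _
      · refine (upperLim_coe_add_le hF _ (isLscLtTop_ind ho)).trans ?_
        refine (add_le_add le_rfl
          ((upperLim_mono (ind_mono (Set.subset_univ _))).trans hM.le)).trans ?_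
        rw [← EReal.coe_add, sub_add_cancel]
    · lift φ y to ℝ using ⟨((hC y).trans_lt (EReal.coe_lt_top C)).ne, hbot⟩ with r hr
      -- Any `a` between `r - γ` and `f y` works: some neighbourhood has mass at most `-a`, and `φ <
      -- γ + a` near `y`.
      have h1 : ((r - γ : ℝ) : EReal) < f y := by
        rw [EReal.coe_sub]
        refine EReal.sub_lt_of_lt_add ?_
        by_contra hle
        rw [not_lt] at hle
        exact absurd (EReal.le_sub_iff_add_le (a := (γ : EReal)) (by simp) (by simp) |>.2
          (by rwa [add_comm])) (not_le.2 hy)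
      obtain ⟨a, ha, haf⟩ := EReal.lt_iff_exists_real_btwn.1 h1
      obtain ⟨G, hG, hyG, hGa⟩ := hf y a haf
      have ho : IsOpen (G ∩ {z | φ z < ((γ + a : ℝ) : EReal)}) :=
        hG.inter (hφ.isOpen_preimage _)
      refine ⟨γ + a, _, ho, ⟨hyG, ?_⟩, fun z hz => le_of_lt hz.2, ?_⟩
      · change φ y < _
        rw [← hr]
        have := EReal.coe_lt_coe_iff.1 ha
        exact_mod_cast (by linarith : r < γ + a)
      · refine (upperLim_coe_add_le hF _ (isLscLtTop_ind ho)).trans ?_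
        refine (add_le_add le_rfl
          ((upperLim_mono (ind_mono Set.inter_subset_left)).trans hGa)).trans ?_
        rw [← EReal.coe_add]
        exact_mod_cast (by linarith : γ + a + -a ≤ γ)
  choose c G hG hyG hle hlim using hloc
  -- Off `K` only `φ ≤ C` is known, so the mass of `Kᶜ` is taken below `γ - C`.
  have hK : (⨅ (K : Set Y) (_ : IsCompact K), upperLim F (ind Kᶜ)) < ((γ - C : ℝ) : EReal) :=
    lt_of_eq_of_lt htight.2 (EReal.bot_lt_coe _)
  simp only [iInf_lt_iff] at hK
  obtain ⟨K, hK, hKlt⟩ := hK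
  obtain ⟨t, -, ht⟩ := hK.elim_nhds_subcover G fun y _ => (hG y).mem_nhds (hyG y)
  have hsup := upperLim_finset_sup_le hF hrho (s := t)
    (ψ := fun y z => (c y : EReal) + ind (G y) z) (γ := γ)
    fun y _ => ⟨(isLscLtTop_ind (hG y)).coe_add _, hlim y⟩
  have hKo : IsOpen Kᶜ := hK.isClosed.isOpen_compl
  have hKlim : upperLim F (fun z => (C : EReal) + ind Kᶜ z) ≤ γ := by
    refine (upperLim_coe_add_le hF _ (isLscLtTop_ind hKo)).trans ?_
    refine (add_le_add le_rfl hKlt.le).trans ?_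
    rw [← EReal.coe_add, add_sub_cancel]
  refine le_trans (upperLim_mono fun z => ?_) (upperLim_sup_le hF hrho hsup.1
    ((isLscLtTop_ind hKo).coe_add C) hsup.2 hKlim)
  by_cases hz : z ∈ K
  · obtain ⟨y, hy, hzy⟩ := Set.mem_iUnion₂.1 (ht hz)
    refine le_trans ?_ (le_sup_left (b := (C : EReal) + ind Kᶜ z))
    refine le_trans ?_ (Finset.le_sup (f := fun y z => (c y : EReal) + ind (G y) z) hy z)
    simpa [ind_of_mem hzy] using hle y z hzy
  · refine le_trans ?_ (le_sup_right (a := (t.sup fun y z => (c y : EReal) + ind (G y) z) z))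
    simpa [ind_of_mem (show z ∈ Kᶜ from hz)] using hC z

end UpperLimit

/-! ### Max-plus linear forms with a density; uniqueness -/

section DensityForm

variable {Y : Type*} [TopologicalSpace Y]

theorem extLsc_eq_densForm [TopologicalSpace.MetrizableSpace Y] {L : Cb Y → EReal}
    {f : Y → EReal} (hL : IsDensity L f) {φ : Y → EReal} (hφ : LowerSemicontinuous φ) :
    extLsc L φ = densForm f φ := by
  refine le_antisymm (iSup₂_le fun χ hχ => (hL χ).le.trans (densForm_mono f hχ)) ?_
  refine iSup_le fun y => sub_le_of_forall_coe_lt fun r hr => ?_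
  obtain ⟨χ, hχ, hy⟩ := exists_Cb_le_of_lt hφ hr
  rw [← hy]
  refine le_trans ?_ (le_iSup₂ (f := fun (χ : Cb Y) (_ : ∀ y, χ y ≤ φ y) => L χ) χ hχ)
  rw [hL χ]
  exact le_iSup (fun y => χ y - f y) y

theorem onSet_eq_of_isOpen [TopologicalSpace.MetrizableSpace Y] {L : Cb Y → EReal}
    {f : Y → EReal} (hL : IsDensity L f) {G : Set Y} (hG : IsOpen G) :
    onSet L G = densForm f (ind G) := by
  rw [onSet, ext_eq_extLsc _ _ (lowerSemicontinuous_ind hG) (ind_lt_top G),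
    extLsc_eq_densForm hL (lowerSemicontinuous_ind hG)]

theorem densForm_le_ext [TopologicalSpace.MetrizableSpace Y] {L : Cb Y → EReal}
    {f : Y → EReal} (hL : IsDensity L f) (φ : Y → EReal) : densForm f φ ≤ ext L φ :=
  le_iInf₂ fun _ hψ => (densForm_mono f hψ.2.2).trans (extLsc_eq_densForm hL hψ.1).ge

/-- On the open set `{f' > r}` the form is at most `-r` when computed with `f'`, and at least `-f y`
when computed with `f`. So an l.s.c. density is the least density. -/
theorem le_of_isDensity [TopologicalSpace.MetrizableSpace Y] {L : Cb Y → EReal}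
    {f f' : Y → EReal} (hf : IsDensity L f) (hf' : IsDensity L f')
    (hlsc : LowerSemicontinuous f') (y : Y) : f' y ≤ f y := by
  refine EReal.ge_of_forall_gt_iff_ge.1 fun r hr => ?_
  have hG : IsOpen {z | (r : EReal) < f' z} := hlsc.isOpen_preimage r
  have h : densForm f (ind {z | (r : EReal) < f' z}) =
      densForm f' (ind {z | (r : EReal) < f' z}) := by
    rw [← onSet_eq_of_isOpen hf hG, ← onSet_eq_of_isOpen hf' hG]
  rw [densForm_ind, densForm_ind] at h
  refine EReal.neg_le_neg_iff.1 ((le_iSup₂ (f := fun z (_ : z ∈ {z | (r : EReal) < f' z}) => -f z)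
    y hr).trans (h.le.trans ?_))
  exact iSup₂_le fun z hz => EReal.neg_le_neg_iff.2 (le_of_lt hz)

/-- The form on `C_b(Y)` with density `f`. -/
noncomputable def formOfDensity (f : Y → EReal) (φ : Cb Y) : EReal := densForm f φ

theorem isDensity_formOfDensity (f : Y → EReal) : IsDensity (formOfDensity f) f := fun _ => rfl

theorem isMaxPlusLinear_formOfDensity (f : Y → EReal) : IsMaxPlusLinear (formOfDensity f) where
  homogeneous a ha φ := by
    change ⨆ y, ((a + φ y) - f y) = a + ⨆ y, (φ y - f y)
    induction a with
    | bot => simp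
    | top => simp at ha
    | coe a =>
      apply le_antisymm
      · refine iSup_le fun y => ?_
        rw [sub_eq_add_neg, add_assoc, ← sub_eq_add_neg]
        exact add_le_add le_rfl (le_iSup (fun y => φ y - f y) y)
      · rw [add_comm]
        refine EReal.add_le_of_le_sub (iSup_le fun y => ?_)
        rw [EReal.le_sub_iff_add_le (by simp) (by simp)]
        refine le_trans (le_of_eq ?_) (le_iSup (fun y => (a : EReal) + φ y - f y) y)
        rw [sub_eq_add_neg, sub_eq_add_neg, add_comm, add_assoc]
  map_sup φ ψ := by
    change ⨆ y, ((φ y ⊔ ψ y) - f y) = (⨆ y, (φ y - f y)) ⊔ ⨆ y, (ψ y - f y)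
    rw [← iSup_sup_eq]
    refine iSup_congr fun y => ?_
    exact (show Monotone fun a : EReal => a - f y from
      fun a b h => EReal.sub_le_sub h le_rfl).map_sup _ _

theorem isContinuousForm_formOfDensity (f : Y → EReal) : IsContinuousForm (formOfDensity f) := by
  intro φ ψ hφ hlim
  have hle : ∀ n y, φ n y ≤ ψ y := fun n y =>
    (show Monotone fun n => φ n y from fun _ _ h => hφ h y).ge_of_tendsto (hlim y) n
  have hsup : formOfDensity f ψ = ⨆ n, formOfDensity f (φ n) := by
    refine le_antisymm (iSup_le fun y => sub_le_of_forall_coe_lt fun r hr => ?_)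
      (iSup_le fun n => densForm_mono f (hle n))
    obtain ⟨n, hn⟩ := ((hlim y).eventually_const_lt hr).exists
    refine le_trans ?_ (le_iSup (fun n => formOfDensity f (φ n)) n)
    exact (EReal.sub_le_sub hn.le le_rfl).trans (le_iSup (fun y => φ n y - f y) y)
  rw [hsup]
  exact tendsto_atTop_iSup fun _ _ h => densForm_mono f (hφ h)

theorem isL_formOfDensity {f : Y → EReal} (hf : densForm f (ind Set.univ) < ⊤) :
    IsL (formOfDensity f) := by
  have hquasi : IsQuasiSupWith 0 (formOfDensity f) := fun φ ψ => by
    rw [zero_add]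
    exact ((isMaxPlusLinear_formOfDensity f).map_sup φ ψ).le
  refine ⟨⟨fun φ => ?_, fun φ ψ h => densForm_mono f h,
    (isMaxPlusLinear_formOfDensity f).homogeneous, ⟨0, EReal.zero_lt_top, hquasi⟩,
    isContinuousForm_formOfDensity f⟩, sInf_le ⟨EReal.zero_lt_top, hquasi⟩⟩
  obtain ⟨c, hc⟩ := φ.2.2
  obtain ⟨M, hM, -⟩ := EReal.lt_iff_exists_real_btwn.1 hf
  refine lt_of_le_of_lt (iSup_le fun y => ?_) (EReal.coe_lt_top (c + M))
  rw [EReal.coe_add, sub_eq_add_neg]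
  refine add_le_add (hc y) (le_trans ?_ hM.le)
  rw [densForm_ind]
  exact le_iSup₂ (f := fun y (_ : y ∈ Set.univ) => -f y) y (Set.mem_univ y)

end DensityForm

/-! ### The rate function of a set function -/

section Rate

variable {Y : Type*} [TopologicalSpace Y]

/-- The lower semicontinuous function whose opposite at `y` is the infimum of the values of a set
function at the open neighbourhoods of `y`. -/
noncomputable def rate (S : Set Y → EReal) (y : Y) : EReal :=
  ⨆ (G : Set Y) (_ : IsOpen G ∧ y ∈ G), -S G

theorem exists_isOpen_of_lt_rate {S : Set Y → EReal} {y : Y} {a : EReal} (h : a < rate S y) :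
    ∃ G, IsOpen G ∧ y ∈ G ∧ a < -S G := by
  simp only [rate, lt_iSup_iff] at h
  obtain ⟨G, ⟨hG, hy⟩, h⟩ := h
  exact ⟨G, hG, hy, h⟩

theorem neg_le_rate {S : Set Y → EReal} {G : Set Y} (hG : IsOpen G) {y : Y} (hy : y ∈ G) :
    -S G ≤ rate S y :=
  le_iSup₂ (f := fun (G : Set Y) (_ : IsOpen G ∧ y ∈ G) => -S G) G ⟨hG, hy⟩

theorem lowerSemicontinuous_rate (S : Set Y → EReal) : LowerSemicontinuous (rate S) := by
  intro y a ha
  obtain ⟨G, hG, hy, h⟩ := exists_isOpen_of_lt_rate ha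
  filter_upwards [hG.mem_nhds hy] with z hz
  exact h.trans_le (neg_le_rate hG hz)

theorem densForm_rate_ind_le (S : Set Y → EReal) {G : Set Y} (hG : IsOpen G) :
    densForm (rate S) (ind G) ≤ S G := by
  rw [densForm_ind]
  exact iSup₂_le fun y hy => EReal.neg_le.1 (neg_le_rate hG hy)

end Rate

/-! ### Attainment in `B f` and the essential set -/

section Inverse

variable {X Y : Type*}

/-- Subtract `b x y - f y ≥ β` from `b z y - f y ≤ g z < M`. Thus coercivity of `b` makes the
superlevel sets of `b x - f` relatively compact. -/
theorem kerDiff_le_of_conj_le {b : X → Y → EReal} (hb : ∀ x y, b x y < ⊤) {f : Y → EReal}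
    {g : X → EReal} (hfg : ∀ x, conj b f x ≤ g x) {x : X} {V : Set X} {M β : ℝ}
    (hV : ∀ z ∈ V, g z < M) {y : Y} (hy : (β : EReal) ≤ b x y - f y) :
    kerDiff b x V y ≤ ((M - β : ℝ) : EReal) := by
  refine iSup₂_le fun z hz => ?_
  have h : b z y - f y ≤ M :=
    (le_iSup (fun y => b z y - f y) y).trans ((hfg z).trans (hV z hz).le)
  have h1 := hb x y
  have h2 := hb z y
  generalize b x y = p at *
  generalize b z y = q at *
  generalize f y = r at *
  induction r with
  | top => simp at hy
  | bot =>
    rcases eq_or_ne q ⊥ with rfl | hq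
    · simp
    · simp [EReal.sub_bot hq] at h
  | coe r =>
    induction p with
    | top => simp at h1
    | bot => simp at hy
    | coe p =>
      induction q with
      | top => simp at h2
      | bot => simp
      | coe q =>
        norm_cast at *
        linarith

variable [TopologicalSpace Y]

/-- In the continuous case, `b < ⊤` and `f > ⊥` keep the sum `b + (-f)` away from the points `(⊤,
⊥)` and `(⊥, ⊤)`, where addition is discontinuous. -/
theorem upperSemicontinuous_sub {b : X → Y → EReal} (hb : ∀ x y, b x y < ⊤) {f : Y → EReal}
    (hf : LowerSemicontinuous f)
    (h : DiscreteTopology Y ∨ ((∀ x, Continuous (b x)) ∧ ∀ y, ⊥ < f y)) (x : X) :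
    UpperSemicontinuous fun y => b x y - f y := by
  rcases h with _ | ⟨hc, hbot⟩
  · exact (continuous_of_discreteTopology (f := fun y => b x y - f y)).upperSemicontinuous
  · have hneg : UpperSemicontinuous fun y => -f y :=
      continuous_neg.comp_lowerSemicontinuous_antitone hf EReal.neg_strictAnti.antitone
    refine (hc x).upperSemicontinuous.add' hneg fun y => ?_
    refine EReal.continuousAt_add (Or.inl (hb x y).ne) (Or.inr ?_)
    simpa [EReal.neg_eq_top_iff] using (hbot y).ne'

/-- A function lying above `B° g`, which coincides with `B° g` at some point of the
subdifferential of `g` at each point of `X'`, coincides with `B° g` on the essential set. -/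
theorem eq_dualConj_of_mem_essentialSet {b : X → Y → EReal} {f : Y → EReal}
    (hf : LowerSemicontinuous f) {g : X → EReal} (hle : ∀ y, dualConj b g y ≤ f y)
    (hq : IsQuasiContinuousOnDom (dualConj b g)) {X' : Set X} (hX' : X' ⊆ dom g)
    (hex : ∀ x ∈ X', ∃ y ∈ ldom (dualConj b g), y ∈ dualSubdiff b g x ∧ f y = dualConj b g y)
    {y : Y} (hy : y ∈ essentialSet b g X') : f y = dualConj b g y := by
  -- Algebraic case: some `x` is covered by `y` alone, so the point given by `hex` at `x` is `y`.
  rcases hy with ⟨-, hy⟩ | ⟨hydom, U, hU, hyU, hUt⟩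
  · obtain ⟨x, hx, hxn⟩ := Set.not_subset.1 hy
    obtain ⟨z, hz, hzx, hfz⟩ := hex x hx.1
    by_cases hzy : z = y
    · rwa [hzy] at hfz
    · exact absurd (Set.mem_iUnion₂.2 ⟨z, ⟨hz, hzy⟩, hzx⟩) hxn
  · refine le_antisymm ?_ (hle y)
    by_contra hlt
    -- Topological case: quasi-continuity yields points `z` of `U ∩ {f > β}` interior to `{B° g <
    -- β}`. Essentiality of `z` gives an `x` whose point `w` from `hex` stays in that region, so `f
    -- w = B° g w < β < f w`.
    obtain ⟨β, hβ, hβf⟩ := EReal.lt_iff_exists_real_btwn.1 (not_le.1 hlt)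
    have hO : IsOpen (U ∩ {z | (β : EReal) < f z}) := hU.inter (hf.isOpen_preimage β)
    have hcl := hq (Set.Iio (β : EReal)) isOpen_Iio
      (show (⟨y, hydom⟩ : dom (dualConj b g)) ∈ _ from hβ)
    obtain ⟨z, hzO, hzint⟩ := mem_closure_iff.1 hcl
      (Subtype.val ⁻¹' (U ∩ {z | (β : EReal) < f z})) (hO.preimage continuous_subtype_val)
      ⟨hyU, hβf⟩
    obtain ⟨O, hOo, hOeq⟩ := isOpen_induced_iff.1
      (isOpen_interior (s := (fun z : dom (dualConj b g) => dualConj b g z) ⁻¹'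
        Set.Iio (β : EReal)))
    have hzO' : (z : Y) ∈ O := by
      rw [← hOeq] at hzint
      exact hzint
    have hzt := (hUt ⟨hzO.1, z.2⟩).2 _ (hO.inter hOo) ⟨hzO, hzO'⟩
    obtain ⟨x, hx, hxn⟩ := Set.not_subset.1 hzt
    obtain ⟨w, hw, hwx, hfw⟩ := hex x hx.1
    by_cases hwO : w ∈ (U ∩ {z | (β : EReal) < f z}) ∩ O
    -- `O` controls `B° g` only inside its domain, so finiteness at `w` has to be checked.
    · have hwdom : w ∈ dom (dualConj b g) := by
        refine ⟨hw, lt_of_lt_of_le ?_ (le_iSup (fun x => b x w - g x) x)⟩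
        rw [bot_lt_iff_ne_bot, sub_eq_add_neg, Ne, EReal.add_eq_bot_iff, not_or]
        exact ⟨hwx.1.1.ne', by simpa using (hX' hx.1).1.ne⟩
      have : (⟨w, hwdom⟩ : dom (dualConj b g)) ∈ Subtype.val ⁻¹' O := hwO.2
      rw [hOeq] at this
      have hwβ : (⟨w, hwdom⟩ : dom (dualConj b g)) ∈
          (fun z : dom (dualConj b g) => dualConj b g z) ⁻¹' Set.Iio (β : EReal) :=
        interior_subset this
      have hβw : (β : EReal) < f w := hwO.1.2
      exact absurd hβw (not_lt.2 (hfw.le.trans (le_of_lt hwβ)))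
    · exact absurd (Set.mem_iUnion₂.2 ⟨w, ⟨hw, hwO⟩, hwx⟩) hxn

variable [TopologicalSpace X]

theorem exists_mem_nhds_lt_of_idom {g : X → EReal} {x : X} (hx : x ∈ idom g) :
    ∃ M : ℝ, ∃ V ∈ 𝓝 x, ∀ z ∈ V, g z < M := by
  obtain ⟨M, hM, -⟩ := EReal.lt_iff_exists_real_btwn.1 hx.2
  exact ⟨M, _, eventually_lt_of_limsup_lt hM, fun z hz => hz⟩

/-- The supremum defining `B f` is attained at the points of `idom g` where `B f = g`. -/
theorem exists_mem_dualSubdiff {b : X → Y → EReal} (hb : ∀ x y, b x y < ⊤) {f : Y → EReal}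
    (hf : LowerSemicontinuous f) {g : X → EReal} (hfg : ∀ x, conj b f x ≤ g x)
    (hcont : DiscreteTopology Y ∨ ((∀ x, Continuous (b x)) ∧ ∀ y, ⊥ < dualConj b g y))
    (hcomp : MemFc b (dualConj b g) ∨ IsCoercive b) {x : X} (hx : x ∈ idom g)
    (hxg : conj b f x = g x) :
    ∃ y ∈ ldom (dualConj b g), y ∈ dualSubdiff b g x ∧ f y = dualConj b g y := by
  have hle : ∀ y, dualConj b g y ≤ f y := (dualConj_le_iff hb).2 hfg
  obtain ⟨M, V, hV, hVM⟩ := exists_mem_nhds_lt_of_idom hx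
  obtain ⟨c, hc⟩ : ∃ c : ℝ, g x = c :=
    ⟨(g x).toReal, (EReal.coe_toReal hx.1.1.ne hx.1.2.ne').symm⟩
  obtain ⟨β, hβ, hβc⟩ : ∃ β : ℝ, (⊥ : EReal) < β ∧ (β : EReal) < g x :=
    EReal.lt_iff_exists_real_btwn.1 hx.1.2
  -- Either `f ≥ B° g` shrinks the superlevel sets of a function in `ℱ_c`, or local boundedness of
  -- `g` near `x` brings in coercivity.
  have hK : IsCompact (closure {y | (β : EReal) ≤ b x y - f y}) := by
    rcases hcomp with h | h
    · exact (h.2 x β).of_isClosed_subset isClosed_closure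
        (closure_mono fun y hy => le_trans hy (EReal.sub_le_sub le_rfl (hle y)))
    · exact (h x V hV (M - β)).of_isClosed_subset isClosed_closure
        (closure_mono fun y hy => kerDiff_le_of_conj_le hb hfg hVM hy)
  have hlt : (β : EReal) < conj b f x := hxg ▸ hβc
  obtain ⟨y₀, hy₀⟩ := lt_iSup_iff.1 hlt
  obtain ⟨y, -, hmax⟩ := UpperSemicontinuousOn.exists_isMaxOn ⟨y₀, subset_closure hy₀.le⟩ hK
    ((upperSemicontinuous_sub hb hf
      (hcont.imp_right fun h => ⟨h.1, fun y => (h.2 y).trans_le (hle y)⟩) x).upperSemicontinuousOn _)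
  have hy : b x y - f y = c := by
    rw [← hc, ← hxg]
    refine le_antisymm (le_iSup (fun y => b x y - f y) y) (iSup_le fun z => ?_)
    by_cases hz : (β : EReal) ≤ b x z - f z
    · exact hmax (subset_closure hz)
    · exact (not_le.1 hz).le.trans (hy₀.le.trans (hmax (subset_closure hy₀.le)))
  have hfin : ∃ p r : ℝ, b x y = p ∧ f y = r := by
    have h1 := hb x y
    generalize b x y = p at *
    generalize f y = r at *
    induction p <;> induction r <;> simp_all
  obtain ⟨p, r, hp, hr⟩ := hfin
  have hpr : p - r = c := by
    rw [hp, hr] at hy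
    exact_mod_cast hy
  -- Finiteness lets `b x y - f y = g x` be rewritten as `f y = b x y - g x ≤ B° g y`. With `B° g ≤
  -- f`, this gives equality and the maximality of `x` in `B° g y`.
  have hval : b x y - g x = r := by
    rw [hp, hc]
    exact_mod_cast (by linarith : p - c = r)
  have hfy : f y = dualConj b g y :=
    le_antisymm (by rw [hr, ← hval]; exact le_iSup (fun x => b x y - g x) x) (hle y)
  refine ⟨y, ?_, ⟨?_, fun x' => ?_⟩, hfy⟩
  · change dualConj b g y < ⊤
    rw [← hfy, hr]
    exact EReal.coe_lt_top r
  · rw [hp]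
    exact ⟨EReal.bot_lt_coe p, EReal.coe_lt_top p⟩
  · rw [hval, ← hr, hfy]
    exact le_iSup (fun x => b x y - g x) x'

end Inverse

/-! ### The rate function solves `B f = g` on `idom g` -/

section Limit

variable {X Y I : Type*} [TopologicalSpace Y]

/-- For `r < b x y`, the set `{b x > r}` is an open neighbourhood of `y`; the Chebyshev inequality
on it gives `r + S G ≤ g x`, while `-S G ≤ f y`. -/
theorem conj_le_of_eq_iSup_upperLim {b : X → Y → EReal} (hb : IsKernel b)
    {F : ℕ → I → Cb Y → EReal} (hQL : ∀ n i, IsQL (F n i)) {g : X → EReal}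
    (hg : ∀ x, g x = ⨆ i, upperLim (fun n => F n i) (b x)) (x : X) :
    conj b (rate fun A => ⨆ i, upperLim (fun n => F n i) (ind A)) x ≤ g x := by
  refine iSup_le fun y => sub_le_of_forall_coe_lt fun r hr => ?_
  have hG : IsOpen {z | (r : EReal) < b x z} := (hb.lsc x).isOpen_preimage r
  have h1 := neg_le_rate (S := fun A => ⨆ i, upperLim (fun n => F n i) (ind A)) hG hr
  refine (EReal.sub_le_sub le_rfl h1).trans ?_
  rw [sub_eq_add_neg, neg_neg, add_comm]
  refine EReal.add_le_of_le_sub (iSup_le fun i => ?_)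
  rw [EReal.le_sub_iff_add_le (by simp) (by simp), add_comm, hg]
  exact (coe_add_upperLim_ind_le (fun n => hQL n i) hG fun z hz => le_of_lt hz).trans
    (le_iSup (fun i => upperLim (fun n => F n i) (b x)) i)

variable [TopologicalSpace X] [PolishSpace Y]

/-- The upper bound `hf` needs functions bounded above, which `b x` may not be. Upper coercivity
bounds it where `kerDiff` is small; elsewhere a kernel `b z` with `z ∈ W` dominates it with room to
spare. -/
theorem le_conj_of_mem_idom {b : X → Y → EReal} (hb : IsKernel b)
    (hcont : ∀ x, Continuous (b x)) (hcoer : IsUpperCoercive b)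
    {F : ℕ → I → Cb Y → EReal} (hQL : ∀ n i, IsQL (F n i))
    (hrho : ∀ i, Tendsto (fun n => rho (F n i)) atTop (𝓝 0)) {g : X → EReal}
    (hg : ∀ x, g x = ⨆ i, upperLim (fun n => F n i) (b x)) {f : Y → EReal}
    (hf : ∀ i, ∀ φ : Y → EReal, UpperSemicontinuous φ → (∃ C : ℝ, ∀ y, φ y ≤ C) →
      upperLim (fun n => F n i) φ ≤ densForm f φ) {x : X} (hx : x ∈ idom g) :
    g x ≤ conj b f x := by
  by_contra hlt
  obtain ⟨s, hs, hsg⟩ := EReal.lt_iff_exists_real_btwn.1 (not_le.1 hlt)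
  obtain ⟨M, V, hV, hVM⟩ := exists_mem_nhds_lt_of_idom hx
  obtain ⟨W, hWfin, hWV, hW⟩ := hcoer x V hV
  obtain ⟨C, hC⟩ := hW (M - s)
  lift W to Finset X using hWfin
  refine absurd hsg (not_lt.2 ?_)
  rw [hg]
  refine iSup_le fun i => ?_
  have hlsc : ∀ z, IsLscLtTop (b z) := fun z => ⟨hb.lsc z, hb.lt_top z⟩
  have hcut : IsLscLtTop fun y => b x y ⊓ C :=
    ⟨(hb.lsc x).inf lowerSemicontinuous_const, fun y => inf_lt_of_left_lt (hb.lt_top x y)⟩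
  have hcutlim : upperLim (fun n => F n i) (fun y => b x y ⊓ C) ≤ s := by
    refine (hf i _ ((hcont x).upperSemicontinuous.inf upperSemicontinuous_const)
      ⟨C, fun y => inf_le_right⟩).trans (le_trans ?_ hs.le)
    exact densForm_mono f fun y => inf_le_left
  -- As `W ⊆ V`, the upper limit at `b z` is at most `M`; the shift `s - M` brings it down to `s`.
  have hsup := upperLim_finset_sup_le (fun n => hQL n i) (hrho i) (s := W)
    (ψ := fun z y => ((s - M : ℝ) : EReal) + b z y) (γ := s) fun z hz => by
      refine ⟨(hlsc z).coe_add _, (upperLim_coe_add_le (fun n => hQL n i) _ (hlsc z)).trans ?_⟩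
      have h1 : upperLim (fun n => F n i) (b z) ≤ M :=
        (le_iSup (fun i => upperLim (fun n => F n i) (b z)) i).trans
          ((hg z).ge.trans (hVM z (hWV hz)).le)
      refine (add_le_add le_rfl h1).trans ?_
      rw [← EReal.coe_add, sub_add_cancel]
  refine le_trans (upperLim_mono fun y => ?_)
    (upperLim_sup_le (fun n => hQL n i) (hrho i) hcut hsup.1 hcutlim hsup.2)
  -- Either `b x y ≤ C`, so that the cut is inactive, or some `z ∈ W` has `b x y ≤ b z y - (M - s)`.
  by_cases hy : kerDiff b x W y ≤ ((M - s : ℝ) : EReal)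
  · exact (le_inf le_rfl (hC y hy)).trans (le_sup_left (b := W.sup (fun z y => ((s - M : ℝ) : EReal) + b z y) y))
  · refine le_trans ?_ (le_sup_right (a := b x y ⊓ C))
    simp only [kerDiff, not_le, lt_iSup_iff] at hy
    obtain ⟨z, hz, hlt⟩ := hy
    refine le_trans ?_ (Finset.le_sup (f := fun z y => ((s - M : ℝ) : EReal) + b z y) hz y)
    have h1 := EReal.add_lt_of_lt_sub hlt
    have h2 : b x y ≤ b z y - ((M - s : ℝ) : EReal) := by
      rw [EReal.le_sub_iff_add_le (Or.inl (EReal.coe_ne_bot _)) (Or.inl (EReal.coe_ne_top _)),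
        add_comm]
      exact h1.le
    refine h2.trans (le_of_eq ?_)
    rw [sub_eq_add_neg, ← EReal.coe_neg, neg_sub, add_comm]

end Limit

end MaxPlus

/-! ### The main theorem -/

theorem mainTheorem3 {X Y I : Type*} [TopologicalSpace X] [T2Space X]
    [TopologicalSpace Y] [PolishSpace Y]
    (b : X → Y → EReal) (hb : IsKernel b)
    (F : ℕ → I → Cb Y → EReal)
    (hQL : ∀ n i, IsQL (F n i))
    (hTight : ∀ i, IsAsympTight (fun n => F n i))
    (hY : ∀ i, limsup (fun n => onSet (F n i) Set.univ) atTop < ⊤)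
    (hrho : ∀ i, Tendsto (fun n => rho (F n i)) atTop (𝓝 0))
    (g : X → EReal)
    (hg : ∀ x, g x = ⨆ i, limsup (fun n => ext (F n i) (b x)) atTop)
    (hA : TechnicalAssumption b g) :
    ∃ (L : Cb Y → EReal) (f : Y → EReal),
      -- `L` is a continuous max-plus linear form, finite above if the masses are bounded above
      IsMaxPlusLinear L ∧ IsContinuousForm L ∧
      ((⨆ i, limsup (fun n => onSet (F n i) Set.univ) atTop) < ⊤ → IsL L) ∧
      -- open and closed bounds
      (∀ G : Set Y, IsOpen G →
        onSet L G ≤ ⨆ i, limsup (fun n => onSet (F n i) G) atTop) ∧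
      (∀ C : Set Y, IsClosed C →
        (⨆ i, limsup (fun n => onSet (F n i) C) atTop) ≤ onSet L C) ∧
      -- `f` is the l.s.c. density of `L`
      (LowerSemicontinuous f ∧ IsDensity L f ∧
        ∀ f' : Y → EReal, LowerSemicontinuous f' → IsDensity L f' → f' = f) ∧
      -- `f` solves the inequality problem, and the covering property holds
      (∀ x, conj b f x ≤ g x) ∧
      (∀ x ∈ idom g ∪ g ⁻¹' {⊥}, conj b f x = g x) ∧
      IsCovering (dualSubdiffInv b g) (ldom (dualConj b g)) (idom g) ∧
      -- comparison with `B° g`, and the upper bound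
      (∀ y, dualConj b g y ≤ f y) ∧
      (∀ C : Set Y, IsClosed C →
        (⨆ i, limsup (fun n => onSet (F n i) C) atTop) ≤ densForm (dualConj b g) (ind C)) ∧
      -- equality on `Z`, and the lower bound
      (∀ y ∈ essentialSet b g (idom g), f y = dualConj b g y) ∧
      (∀ G : Set Y, IsOpen G →
        densForm (dualConj b g) (ind (G ∩ essentialSet b g (idom g))) ≤
          ⨆ i, limsup (fun n => onSet (F n i) G) atTop) := by
  let S : Set Y → EReal := fun A => ⨆ i, upperLim (fun n => F n i) (ind A)
  have hg' : ∀ x, g x = ⨆ i, upperLim (fun n => F n i) (b x) := hg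
  have hS : ∀ i A, upperLim (fun n => F n i) (ind A) ≤ S A := fun i A =>
    le_iSup (fun i => upperLim (fun n => F n i) (ind A)) i
  have hdens : IsDensity (formOfDensity (rate S)) (rate S) := isDensity_formOfDensity _
  -- Each `F_{n,i}` is compared with the common rate function: its mass on a set is at most `S`, so
  -- no uniformity of the tightness in `i` is required.
  have hupper : ∀ i, ∀ φ : Y → EReal, UpperSemicontinuous φ → (∃ C : ℝ, ∀ y, φ y ≤ C) →
      upperLim (fun n => F n i) φ ≤ densForm (rate S) φ := by
    rintro i φ hφ ⟨C, hC⟩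
    refine upperLim_le_densForm (fun n => hQL n i) (hrho i) (hTight i) (hY i)
      (fun y a ha => ?_) hφ hC
    obtain ⟨G, hG, hyG, h⟩ := exists_isOpen_of_lt_rate ha
    refine ⟨G, hG, hyG, (hS i G).trans ?_⟩
    rw [EReal.coe_neg]
    exact (EReal.lt_neg_comm.1 h).le
  have hclosed : ∀ C : Set Y, IsClosed C → S C ≤ densForm (rate S) (ind C) := fun C hC =>
    iSup_le fun i => hupper i _ (upperSemicontinuous_ind hC) ⟨0, fun y => by
      rw [EReal.coe_zero, ← ind_of_mem (Set.mem_univ y)]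
      exact ind_mono (Set.subset_univ C) y⟩
  have hfg : ∀ x, conj b (rate S) x ≤ g x := conj_le_of_eq_iSup_upperLim hb hQL hg'
  have hle : ∀ y, dualConj b g y ≤ rate S y := (dualConj_le_iff hb.lt_top).2 hfg
  have hcont : ∀ x, Continuous (b x) := by
    rcases hA.discrete_or with _ | h
    · exact fun x => continuous_of_discreteTopology
    · exact h.1
  have heq : ∀ x ∈ idom g, conj b (rate S) x = g x := fun x hx =>
    le_antisymm (hfg x) (le_conj_of_mem_idom hb hcont hA.upperCoercive hQL hrho hg' hupper hx)
  have hex : ∀ x ∈ idom g, ∃ y ∈ ldom (dualConj b g),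
      y ∈ dualSubdiff b g x ∧ rate S y = dualConj b g y := fun x hx =>
    exists_mem_dualSubdiff hb.lt_top (lowerSemicontinuous_rate S) hfg hA.discrete_or
      hA.memFc_or hx (heq x hx)
  have hZ : ∀ y ∈ essentialSet b g (idom g), rate S y = dualConj b g y := fun y =>
    eq_dualConj_of_mem_essentialSet (lowerSemicontinuous_rate S) hle hA.quasiContinuous
      (fun x hx => hx.1) hex
  refine ⟨formOfDensity (rate S), rate S, isMaxPlusLinear_formOfDensity _,
    isContinuousForm_formOfDensity _, fun h => isL_formOfDensity
      ((densForm_rate_ind_le S isOpen_univ).trans_lt h), fun G hG => ?_, fun C hC => ?_,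
    ⟨lowerSemicontinuous_rate S, hdens, fun f' hf' hd => ?_⟩, hfg, ?_, fun x hx => ?_, hle,
    fun C hC => ?_, hZ, fun G hG => ?_⟩
  · rw [onSet_eq_of_isOpen hdens hG]
    exact densForm_rate_ind_le S hG
  · exact (hclosed C hC).trans (densForm_le_ext hdens _)
  · exact funext fun y => le_antisymm (le_of_isDensity hdens hd hf' y)
      (le_of_isDensity hd hdens (lowerSemicontinuous_rate S) y)
  · rintro x (hx | hx)
    · exact heq x hx
    · rw [Set.mem_preimage, Set.mem_singleton_iff] at hx
      exact le_antisymm (hfg x) (hx.le.trans bot_le)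
  · obtain ⟨y, hy, hyx, -⟩ := hex x hx
    exact Set.mem_iUnion₂.2 ⟨y, hy, hyx⟩
  · exact (hclosed C hC).trans (densForm_anti hle _)
  · refine le_trans ?_ (densForm_rate_ind_le S hG)
    rw [densForm_ind, densForm_ind]
    refine iSup₂_le fun y hy => ?_
    rw [← hZ y hy.2]
    exact le_iSup₂ (f := fun y (_ : y ∈ G) => -rate S y) y hy.1
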